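/- A partition with designated summands of a non-negative integer $n$ is an integer partition of $n$ together with, for each part size that occurs in it, a choice of exactly one of the occurrences of that part size (the designated one). A partition is called $2$-regular if none of its parts is divisible by $2$, that is, if all its parts are odd. Let $PD_2(n)$ denote the number of $2$-regular partitions of $n$ with designated summands; for example $PD_2(0)=1$ and $PD_2(4)=5$. **Theorem.** For all integers $n \ge 0$, $$PD_2(4n) \equiv PD_2(n) \pmod 4.$$ -/

import Mathlib

/-- A partition of `n` is `k`-regular if none of its parts is divisible by `k`. -/
def Nat.Partition.IsRegular (k : ℕ) {n : ℕ} (p : n.Partition) : Prop :=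
  ∀ i ∈ p.parts, ¬ k ∣ i

instance Nat.Partition.decidableIsRegular (k : ℕ) {n : ℕ} (p : n.Partition) :
    Decidable (p.IsRegular k) :=
  inferInstanceAs (Decidable (∀ i ∈ p.parts, ¬ k ∣ i))

/-- A designation of summands in a partition `p`: for every part size `i` that occurs in `p`, the
choice of exactly one of the `p.parts.count i` occurrences of `i`. -/
abbrev Nat.Partition.Designation {n : ℕ} (p : n.Partition) : Type :=
  (i : {i // i ∈ p.parts.toFinset}) → Fin (p.parts.count i.1)

/-- The `k`-regular partitions of `n` with designated summands: a `k`-regular partition of `n`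
together with a designation of its summands. -/
abbrev RegularDesignatedPartition (k n : ℕ) : Type :=
  (p : {p : n.Partition // p.IsRegular k}) × p.1.Designation

/-- `PD k n` is the number `PD_k(n)` of `k`-regular partitions of `n` with designated summands. -/
def PD (k n : ℕ) : ℕ :=
  Fintype.card (RegularDesignatedPartition k n)

/-! Let F(q) = ∑ PD₂(n) qⁿ. A part size i contributes 1 + qⁱ/(1-qⁱ)² = (1+ωqⁱ)(1+ω⁻¹qⁱ)/(1-qⁱ)²,
with ω a primitive cube root of unity. Taking the product over odd i, the Jacobi triple product
gives F = θ(ω)/θ(-1), where θ(z) = ∑ zⁿ q^(n²) (`genFunPD_mul_thetaSeries`). Splitting θ(z)θ(1) by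
parity, for z = ω and z = -1, and dividing yields F(q) = F(q²)² + q Y(q²)² with Y integral
(`exists_genFunPD_eq_expand_add`). Taking even parts twice gives ∑ PD₂(4n) qⁿ = F⁴ + qY⁴. Since
G(q)⁴ ≡ G(q²)² mod 4 for every integral G, this is congruent to F(q²)² + q Y(q²)² = F(q). -/

/-! ### Gaussian binomials and the finite q-binomial theorem. -/

section QBinomial

variable {R : Type*} [CommRing R]

/-- The Gaussian binomial coefficient, as the value at `Q` of the polynomial given by the
`q`-Pascal rule. -/
def qBinom (Q : R) : ℕ → ℕ → R
  | _, 0 => 1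
  | 0, _ + 1 => 0
  | n + 1, k + 1 => qBinom Q n k + Q ^ (k + 1) * qBinom Q n (k + 1)

/-- The finite `q`-Pochhammer symbol `(Q; Q)_n`. -/
def qPoch (Q : R) (n : ℕ) : R :=
  ∏ k ∈ Finset.range n, (1 - Q ^ (k + 1))

@[simp]
lemma qBinom_zero_right (Q : R) (n : ℕ) : qBinom Q n 0 = 1 := by
  cases n <;> rfl

lemma qBinom_succ_succ (Q : R) (n k : ℕ) :
    qBinom Q (n + 1) (k + 1) = qBinom Q n k + Q ^ (k + 1) * qBinom Q n (k + 1) := rfl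

lemma qBinom_eq_zero_of_lt (Q : R) {n k : ℕ} (h : n < k) : qBinom Q n k = 0 := by
  induction n generalizing k with
  | zero => obtain ⟨k, rfl⟩ := Nat.exists_eq_succ_of_ne_zero h.ne'; rfl
  | succ n ih =>
    obtain ⟨k, rfl⟩ := Nat.exists_eq_succ_of_ne_zero (Nat.ne_of_gt (Nat.zero_lt_of_lt h))
    rw [Nat.succ_eq_add_one, qBinom_succ_succ, ih (by omega), ih (by omega)]
    ring

@[simp]
lemma qBinom_self (Q : R) (n : ℕ) : qBinom Q n n = 1 := by
  induction n with
  | zero => rfl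
  | succ n ih => rw [qBinom_succ_succ, ih, qBinom_eq_zero_of_lt Q (Nat.lt_succ_self n)]; ring

@[simp]
lemma qPoch_zero (Q : R) : qPoch Q 0 = 1 := by simp [qPoch]

lemma qPoch_succ (Q : R) (n : ℕ) : qPoch Q (n + 1) = qPoch Q n * (1 - Q ^ (n + 1)) :=
  Finset.prod_range_succ _ _

lemma qBinom_mul_qPoch (Q : R) (i j : ℕ) :
    qBinom Q (i + j) j * (qPoch Q i * qPoch Q j) = qPoch Q (i + j) := by
  induction i generalizing j with
  | zero => simp
  | succ i ih =>
    induction j with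
    | zero => simp
    | succ j ih' =>
      have h₁ := ih (j + 1)
      rw [show i + 1 + (j + 1) = (i + 1 + j) + 1 by ring, qBinom_succ_succ, qPoch_succ Q (i + 1 + j)]
      rw [show i + (j + 1) = i + 1 + j by ring] at h₁
      rw [← mul_comm (1 - _), sub_mul, one_mul]
      nth_rewrite 2 [← h₁]
      rw [← ih', qPoch_succ Q i, qPoch_succ Q j]
      rw [qPoch_succ Q j] at h₁
      rw [qPoch_succ Q i] at ih'
      have e : qBinom Q (i + 1 + j) j * (qPoch Q i * (1 - Q ^ (i + 1)) * qPoch Q j) =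
        qBinom Q (i + 1 + j) (j + 1) * (qPoch Q i * (qPoch Q j * (1 - Q ^ (j + 1)))) :=
        ih'.trans h₁.symm
      have e₁ : Q ^ (i + 1 + j + 1) = Q ^ (i + 1) * Q ^ (j + 1) := by ring
      rw [e₁]
      -- Rests on 1 - Q^(i+j+2) = (1 - Q^(j+1)) + Q^(j+1) (1 - Q^(i+1)).
      linear_combination (- Q ^ (j + 1)) * e

/-- The `q`-binomial theorem in homogeneous form. -/
lemma prod_add_mul_pow_eq_sum_qBinom (Q x y : R) (n : ℕ) :
    ∏ k ∈ Finset.range n, (y + x * Q ^ k) =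
      ∑ j ∈ Finset.range (n + 1), Q ^ (j.choose 2) * qBinom Q n j * x ^ j * y ^ (n - j) := by
  induction n generalizing x with
  | zero => simp
  | succ n ih =>
    have e : ∀ k, y + x * Q ^ (k + 1) = y + (x * Q) * Q ^ k := fun k => by ring
    rw [Finset.prod_range_succ', pow_zero, mul_one]
    simp_rw [e]
    rw [ih, mul_add, Finset.sum_range_succ' _ (n + 1)]
    have h₁ : ∀ j ∈ Finset.range (n + 1),
        Q ^ ((j + 1).choose 2) * qBinom Q (n + 1) (j + 1) * x ^ (j + 1) * y ^ (n + 1 - (j + 1)) =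
        Q ^ (j.choose 2) * qBinom Q n j * (x * Q) ^ j * y ^ (n - j) * x +
        Q ^ ((j + 1).choose 2) * qBinom Q n (j + 1) * (x * Q) ^ (j + 1) * y ^ (n - j) := by
      intro j _
      rw [qBinom_succ_succ, Nat.add_sub_add_right, Nat.choose_succ_succ' j 1, Nat.choose_one_right]
      ring
    rw [Finset.sum_congr rfl h₁, Finset.sum_add_distrib, ← Finset.sum_mul,
      Finset.sum_range_succ' _ n, Finset.sum_range_succ _ n,
      qBinom_eq_zero_of_lt Q (Nat.lt_succ_self n), add_mul, Finset.sum_mul]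
    have h₂ : ∀ j ∈ Finset.range n,
        Q ^ ((j + 1).choose 2) * qBinom Q n (j + 1) * (x * Q) ^ (j + 1) * y ^ (n - j) =
        Q ^ ((j + 1).choose 2) * qBinom Q n (j + 1) * (x * Q) ^ (j + 1) * y ^ (n - (j + 1)) * y := by
      intro j hj
      rw [show n - j = n - (j + 1) + 1 by have := Finset.mem_range.mp hj; omega]
      ring
    rw [Finset.sum_congr rfl h₂]
    simp
    ring

lemma pow_dvd_qPoch_sub_qPoch (Q : R) {m n : ℕ} (h : m ≤ n) :
    Q ^ (m + 1) ∣ qPoch Q n - qPoch Q m := by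
  induction n, h using Nat.le_induction with
  | base => simp
  | succ n h ih =>
    rw [qPoch_succ, show qPoch Q n * (1 - Q ^ (n + 1)) - qPoch Q m =
      (qPoch Q n - qPoch Q m) - Q ^ (n + 1) * qPoch Q n by ring]
    exact dvd_sub ih (Dvd.dvd.mul_right (pow_dvd_pow Q (by omega)) _)

/-- Quantitative form of the limit of Gaussian binomials to 1/(Q;Q)_∞: `qPoch Q (i + j)` agrees with
both `qPoch Q i` and `qPoch Q j` to the stated order. -/
lemma pow_dvd_qBinom_mul_qPoch_sub_one {Q : R} (hQ : ∀ n, IsUnit (qPoch Q n)) (i j : ℕ) :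
    Q ^ (min i j + 1) ∣ qBinom Q (i + j) j * qPoch Q (i + j) - 1 := by
  have h₁ : Q ^ (min i j + 1) ∣ qPoch Q (i + j) - qPoch Q i :=
    (pow_dvd_pow Q (by omega)).trans (pow_dvd_qPoch_sub_qPoch Q (Nat.le_add_right i j))
  have h₂ : Q ^ (min i j + 1) ∣ qPoch Q (i + j) - qPoch Q j :=
    (pow_dvd_pow Q (by omega)).trans (pow_dvd_qPoch_sub_qPoch Q (Nat.le_add_left j i))
  rw [← (hQ j).dvd_mul_left]
  have h := qBinom_mul_qPoch Q i j
  rw [show qPoch Q j * (qBinom Q (i + j) j * qPoch Q (i + j) - 1) =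
    qBinom Q (i + j) j * qPoch Q j * (qPoch Q (i + j) - qPoch Q i) +
      (qPoch Q (i + j) - qPoch Q j) by linear_combination h]
  exact dvd_add (Dvd.dvd.mul_left h₁ _) h₂

end QBinomial

/-! ### Finite Jacobi triple product. -/

section FiniteTripleProduct

open PowerSeries

variable {R : Type*} [CommRing R]

/-- The finite form of the Jacobi triple product identity. -/
lemma finite_triple_product (z : Rˣ) (N : ℕ) :
    ∏ k ∈ Finset.range N,
        ((1 + C (z : R) * X ^ (2 * k + 1)) * (1 + C ((z⁻¹ : Rˣ) : R) * X ^ (2 * k + 1))) =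
      ∑ j ∈ Finset.range (2 * N + 1), C ((z ^ ((j : ℤ) - N) : Rˣ) : R) *
        X ^ (((j : ℤ) - N).natAbs ^ 2) * qBinom (X ^ 2 : R⟦X⟧) (2 * N) j := by
  have hN : ∑ k ∈ Finset.range N, (2 * k + 1) = N ^ 2 := by
    induction N with
    | zero => rfl
    | succ n ih => rw [Finset.sum_range_succ, ih]; ring
  have hc : ∀ j : ℕ, 2 * j.choose 2 + j = j ^ 2 := fun j => by
    induction j with
    | zero => rfl
    | succ n ih =>
      rw [Nat.choose_succ_succ' n 1, Nat.choose_one_right]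
      linear_combination ih
  have hX : IsLeftRegular ((X : R⟦X⟧) ^ (3 * N ^ 2)) := by
    intro a b hab
    exact X_pow_mul_cancel hab
  have hz : IsLeftRegular (C (z : R) ^ N) :=
    ((z.isUnit.map (C (R := R))).pow N).isRegular.left
  apply (hX.mul hz)
  -- Taking y = X^(2N) avoids negative powers of X. The factors with k < N become those in z⁻¹, the
  -- others those in z, once X^(3N²) z^N is pulled out.
  have key := prod_add_mul_pow_eq_sum_qBinom (X ^ 2 : R⟦X⟧) (C (z : R) * X) (X ^ (2 * N)) (2 * N)
  have hl : ∏ k ∈ Finset.range (2 * N), ((X : R⟦X⟧) ^ (2 * N) + C (z : R) * X * (X ^ 2) ^ k) =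
      X ^ (3 * N ^ 2) * C (z : R) ^ N * ∏ k ∈ Finset.range N,
        ((1 + C (z : R) * X ^ (2 * k + 1)) * (1 + C ((z⁻¹ : Rˣ) : R) * X ^ (2 * k + 1))) := by
    rw [two_mul N, Finset.prod_range_add, Finset.prod_mul_distrib, ← two_mul N]
    have e₁ : ∏ k ∈ Finset.range N,
        ((X : R⟦X⟧) ^ (2 * N) + C (z : R) * X * (X ^ 2) ^ (N + k)) =
        X ^ (2 * N ^ 2) * ∏ k ∈ Finset.range N, (1 + C (z : R) * X ^ (2 * k + 1)) := by
      rw [show (X : R⟦X⟧) ^ (2 * N ^ 2) = ∏ k ∈ Finset.range N, X ^ (2 * N) by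
        rw [Finset.prod_const, Finset.card_range]; ring, ← Finset.prod_mul_distrib]
      exact Finset.prod_congr rfl fun k _ => by ring
    have e₂ : ∏ k ∈ Finset.range N, ((X : R⟦X⟧) ^ (2 * N) + C (z : R) * X * (X ^ 2) ^ k) =
        X ^ (N ^ 2) * (C (z : R) ^ N *
          ∏ k ∈ Finset.range N, (1 + C ((z⁻¹ : Rˣ) : R) * X ^ (2 * k + 1))) := by
      have e₃ : C (z : R) ^ N * ∏ k ∈ Finset.range N, (1 + C ((z⁻¹ : Rˣ) : R) * X ^ (2 * k + 1)) =
          ∏ k ∈ Finset.range N, (C (z : R) + X ^ (2 * (N - 1 - k) + 1)) := by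
        rw [Finset.prod_range_reflect (fun k => C (z : R) + (X : R⟦X⟧) ^ (2 * k + 1)) N,
          show C (z : R) ^ N = ∏ _k ∈ Finset.range N, C (z : R) by simp,
          ← Finset.prod_mul_distrib]
        refine Finset.prod_congr rfl fun k _ => ?_
        rw [mul_add, mul_one, ← mul_assoc, ← map_mul, Units.mul_inv, map_one, one_mul]
      rw [e₃, ← hN, ← Finset.prod_pow_eq_pow_sum, ← Finset.prod_mul_distrib]
      refine Finset.prod_congr rfl fun k hk => ?_
      rw [show 2 * N = 2 * k + 1 + (2 * (N - 1 - k) + 1) by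
        have := Finset.mem_range.mp hk; omega]
      ring
    rw [e₁, e₂]
    ring
  rw [hl] at key
  beta_reduce
  rw [key, Finset.mul_sum]
  refine Finset.sum_congr rfl fun j hj => ?_
  have hj' : j ≤ 2 * N := by have := Finset.mem_range.mp hj; omega
  have hz' : C (z : R) ^ N * C ((z ^ ((j : ℤ) - N) : Rˣ) : R) = C (z : R) ^ j := by
    rw [← map_pow, ← map_mul, ← map_pow, ← Units.val_pow_eq_pow_val, ← Units.val_pow_eq_pow_val,
      ← Units.val_mul, ← zpow_natCast, ← zpow_add, ← zpow_natCast]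
    congr 3
    ring_nf
  have hx' : ((X : R⟦X⟧) ^ 2) ^ (j.choose 2) * X ^ j * (X ^ (2 * N)) ^ (2 * N - j) =
      X ^ (3 * N ^ 2) * X ^ (((j : ℤ) - N).natAbs ^ 2) := by
    rw [← pow_mul, ← pow_mul, ← pow_add, ← pow_add, ← pow_add]
    congr 1
    rw [hc]
    zify [hj']
    rw [sq_abs]
    ring
  linear_combination (qBinom (X ^ 2 : R⟦X⟧) (2 * N) j * C (z : R) ^ j) * hx' -
    (X ^ (3 * N ^ 2) * X ^ (((j : ℤ) - N).natAbs ^ 2) * qBinom (X ^ 2 : R⟦X⟧) (2 * N) j) * hz'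

end FiniteTripleProduct

/-! ### Passage to the limit in the triple product. -/

section TripleProduct

open PowerSeries PowerSeries.WithPiTopology Filter Topology

variable {R : Type*} [CommRing R]

lemma isUnit_qPoch_X_pow (m n : ℕ) (hm : m ≠ 0) : IsUnit (qPoch (X ^ m : R⟦X⟧) n) := by
  rw [isUnit_iff_constantCoeff, qPoch, map_prod]
  simp [hm]

lemma coeff_prod_mul_qPoch (z : Rˣ) {d N : ℕ} (h : d ≤ N) :
    coeff d ((∏ k ∈ Finset.range N,
        ((1 + C (z : R) * X ^ (2 * k + 1)) * (1 + C ((z⁻¹ : Rˣ) : R) * X ^ (2 * k + 1)))) *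
        qPoch (X ^ 2 : R⟦X⟧) (2 * N)) =
      coeff d (∑ j ∈ Finset.range (2 * N + 1),
        C ((z ^ ((j : ℤ) - N) : Rˣ) : R) * (X : R⟦X⟧) ^ (((j : ℤ) - N).natAbs ^ 2)) := by
  rw [finite_triple_product, Finset.sum_mul, map_sum, map_sum]
  refine Finset.sum_congr rfl fun j hj => ?_
  have hj' : j ≤ 2 * N := by have := Finset.mem_range.mp hj; omega
  obtain ⟨i, hi⟩ := Nat.exists_eq_add_of_le' hj'
  have h₁ := pow_dvd_qBinom_mul_qPoch_sub_one (Q := (X ^ 2 : R⟦X⟧))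
    (fun n => isUnit_qPoch_X_pow 2 n two_ne_zero) i j
  rw [← hi] at h₁
  rw [← sub_eq_zero, ← map_sub]
  have hd : (X : R⟦X⟧) ^ (N + 1) ∣ C ((z ^ ((j : ℤ) - N) : Rˣ) : R) *
      X ^ (((j : ℤ) - N).natAbs ^ 2) * (qBinom (X ^ 2) (2 * N) j * qPoch (X ^ 2) (2 * N) - 1) := by
    have h₂ := mul_dvd_mul (Dvd.intro_left (C ((z ^ ((j : ℤ) - N) : Rˣ) : R))
      (rfl : _ * (X : R⟦X⟧) ^ (((j : ℤ) - N).natAbs ^ 2) = _)) h₁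
    refine dvd_trans ?_ h₂
    rw [← pow_mul, ← pow_add]
    refine pow_dvd_pow _ ?_
    generalize hm : ((j : ℤ) - N).natAbs = m
    have h₃ : N ≤ min i j + m := by omega
    -- m² + 2(min i j + 1) ≥ (m-1)² + 2N + 1, so the error in each term lies beyond degree N.
    nlinarith [sq_nonneg ((m : ℤ) - 1), Nat.le_self_pow two_ne_zero m]
  rw [show ∀ a b c : R⟦X⟧, a * b * c - a = a * (b * c - 1) from fun a b c => by ring]
  exact X_pow_dvd_iff.mp hd d (by omega)

lemma tendsto_order_C_mul_X_pow (c : R) {e : ℕ → ℕ} (he : ∀ k, k ≤ e k) :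
    Tendsto (fun k => (C c * (X : R⟦X⟧) ^ e k).order) atTop (𝓝 ⊤) := by
  refine ENat.tendsto_nhds_top_iff_natCast_lt.mpr fun n => eventually_atTop.mpr ⟨n + 1, ?_⟩
  intro m hm
  refine lt_of_lt_of_le ?_ (le_order_mul _ _)
  refine lt_of_lt_of_le ?_ le_add_self
  refine lt_of_lt_of_le ?_ (le_order_pow_of_constantCoeff_eq_zero _ (by simp))
  exact_mod_cast lt_of_lt_of_le (Nat.lt_of_succ_le hm) (he m)

variable [TopologicalSpace R]

lemma summable_C_mul_X_pow {ι : Type*} (w : ι → R) {e : ι → ℕ}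
    (he : ∀ d, {i | e i = d}.Finite) : Summable fun i => C (w i) * (X : R⟦X⟧) ^ e i := by
  rw [summable_iff_summable_coeff]
  intro d
  refine summable_of_hasFiniteSupport ((he d).subset fun i hi => ?_)
  by_contra h
  refine hi ?_
  beta_reduce
  rw [coeff_C_mul, coeff_X_pow, if_neg fun h' => h h'.symm, mul_zero]

/-- The theta series `∑ zⁿ q^(n²)`, the sum being over all integers `n`. -/
noncomputable def thetaSeries (z : Rˣ) : R⟦X⟧ :=
  ∑' n : ℤ, C ((z ^ n : Rˣ) : R) * X ^ (n.natAbs ^ 2)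

lemma finite_natAbs_sq_eq (d : ℕ) : {n : ℤ | n.natAbs ^ 2 = d}.Finite := by
  refine (Set.finite_Icc (-d : ℤ) d).subset fun n hn => ?_
  have : n.natAbs ≤ d := by
    rw [← show n.natAbs ^ 2 = d from hn]
    exact Nat.le_self_pow two_ne_zero _
  simp only [Set.mem_Icc]
  omega

lemma hasSum_thetaSeries (z : Rˣ) :
    HasSum (fun n : ℤ => C ((z ^ n : Rˣ) : R) * (X : R⟦X⟧) ^ (n.natAbs ^ 2)) (thetaSeries z) :=
  (summable_C_mul_X_pow _ finite_natAbs_sq_eq).hasSum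

lemma tendsto_sum_thetaSeries (z : Rˣ) :
    Tendsto (fun N : ℕ => ∑ j ∈ Finset.range (2 * N + 1),
      C ((z ^ ((j : ℤ) - N) : Rˣ) : R) * (X : R⟦X⟧) ^ (((j : ℤ) - N).natAbs ^ 2))
      atTop (𝓝 (thetaSeries z)) := by
  have h : Tendsto (fun N : ℕ => Finset.Icc (-N : ℤ) N) atTop atTop := by
    refine tendsto_atTop_finset_of_monotone (fun a b hab => ?_) fun x => ⟨x.natAbs, ?_⟩
    · exact Finset.Icc_subset_Icc (by omega) (by omega)
    · simp only [Finset.mem_Icc]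
      omega
  refine ((hasSum_thetaSeries z).comp h).congr fun N => ?_
  symm
  refine Finset.sum_bij (fun (j : ℕ) _ => (j : ℤ) - N) ?_ ?_ ?_ fun _ _ => rfl
  · intro j hj
    simp only [Finset.mem_range, Finset.mem_Icc] at *
    omega
  · intro a _ b _ h
    omega
  · intro b hb
    simp only [Finset.mem_Icc] at hb
    exact ⟨(b + N).toNat, by simp only [Finset.mem_range]; omega, by omega⟩

lemma multipliable_one_add_C_mul_X_pow (c : R) {e : ℕ → ℕ} (he : ∀ k, k ≤ e k) :
    Multipliable fun k => 1 + C c * (X : R⟦X⟧) ^ e k :=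
  multipliable_one_add_of_tendsto_order_atTop_nhds_top _ (tendsto_order_C_mul_X_pow c he)

/-- The Jacobi triple product identity. -/
theorem triple_product [IsTopologicalRing R] [T2Space R] (z : Rˣ) :
    (∏' k : ℕ, ((1 + C (z : R) * (X : R⟦X⟧) ^ (2 * k + 1)) *
      (1 + C ((z⁻¹ : Rˣ) : R) * X ^ (2 * k + 1)))) *
      ∏' k : ℕ, (1 - ((X : R⟦X⟧) ^ 2) ^ (k + 1)) = thetaSeries z := by
  have hE : Multipliable fun k : ℕ => 1 - ((X : R⟦X⟧) ^ 2) ^ (k + 1) := by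
    refine (multipliable_one_add_C_mul_X_pow (-1 : R) (e := fun k => 2 * (k + 1))
      fun k => by omega).congr fun k => ?_
    rw [map_neg, map_one]
    ring
  have hP := (multipliable_one_add_C_mul_X_pow (z : R) (e := fun k => 2 * k + 1)
    fun k => by omega).mul (multipliable_one_add_C_mul_X_pow ((z⁻¹ : Rˣ) : R)
      (e := fun k => 2 * k + 1) fun k => by omega)
  have h₁ := hP.hasProd.tendsto_prod_nat.mul (hE.hasProd.tendsto_prod_nat.comp
    (tendsto_id.const_mul_atTop' (Nat.zero_lt_two)))
  refine tendsto_nhds_unique h₁ ((tendsto_iff_coeff_tendsto _ _ _ _).mpr fun d => ?_)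
  refine ((tendsto_iff_coeff_tendsto _ _ _ _).mp (tendsto_sum_thetaSeries z) d).congr' ?_
  filter_upwards [eventually_ge_atTop d] with N hN
  exact (coeff_prod_mul_qPoch z hN).symm

end TripleProduct

/-! ### Parity dissection of products of theta series. -/

section ThetaDissection

open PowerSeries PowerSeries.WithPiTopology Filter Topology

lemma finite_add_eq {ι κ : Type*} {e : ι → ℕ} {f : κ → ℕ}
    (he : ∀ d, {i | e i = d}.Finite) (hf : ∀ d, {i | f i = d}.Finite) (d : ℕ) :
    {p : ι × κ | e p.1 + f p.2 = d}.Finite := by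
  refine (((Set.finite_Iic d).biUnion fun a _ => he a).prod
    ((Set.finite_Iic d).biUnion fun a _ => hf a)).subset fun p hp => ?_
  have hp' : e p.1 + f p.2 = d := hp
  simp only [Set.mem_prod, Set.mem_iUnion, Set.mem_ofPred_eq, Set.mem_Iic]
  exact ⟨⟨e p.1, by omega, rfl⟩, ⟨f p.2, by omega, rfl⟩⟩

lemma HasSum.powerSeries_expand {R ι : Type*} [CommRing R] [TopologicalSpace R] {f : ι → R⟦X⟧}
    {g : R⟦X⟧} (h : HasSum f g) (p : ℕ) (hp : p ≠ 0) :
    HasSum (fun i => expand p hp (f i)) (expand p hp g) := by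
  rw [hasSum_iff_hasSum_coeff] at h ⊢
  intro d
  simp_rw [coeff_expand]
  split_ifs
  · exact h _
  · exact hasSum_zero

lemma HasSum.powerSeries_map {R S ι : Type*} [CommRing R] [TopologicalSpace R] [CommRing S]
    [TopologicalSpace S] {f : ι → R⟦X⟧} {g : R⟦X⟧} (h : HasSum f g) (φ : R →+* S)
    (hφ : Continuous φ) : HasSum (fun i => PowerSeries.map φ (f i)) (PowerSeries.map φ g) := by
  rw [hasSum_iff_hasSum_coeff] at h ⊢
  intro d
  simp_rw [coeff_map]
  exact (h d).map φ hφ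

lemma t3Space_powerSeries {R : Type*} [TopologicalSpace R] [T3Space R] : T3Space R⟦X⟧ :=
  inferInstanceAs (T3Space ((Unit →₀ ℕ) → R))

variable {R : Type*} [CommRing R] [TopologicalSpace R]

/-- The series `∑ zᵃ q^(a(a+1))`, the sum being over all integers `a`. -/
noncomputable def oblongSeries (z : Rˣ) : R⟦X⟧ :=
  ∑' a : ℤ, C ((z ^ a : Rˣ) : R) * X ^ (a * (a + 1)).natAbs

lemma natAbs_le_natAbs_mul_succ (a : ℤ) : a.natAbs ≤ (a * (a + 1)).natAbs + 1 := by
  rw [Int.natAbs_mul]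
  rcases eq_or_ne a (-1) with rfl | h
  · simp
  · have : 1 ≤ (a + 1).natAbs := by omega
    exact (Nat.le_mul_of_pos_right _ this).trans (Nat.le_succ _)

lemma finite_natAbs_mul_succ_eq (d : ℕ) : {a : ℤ | (a * (a + 1)).natAbs = d}.Finite := by
  refine (Set.finite_Icc (-(d + 1) : ℤ) (d + 1)).subset fun a ha => ?_
  have h := natAbs_le_natAbs_mul_succ a
  rw [show (a * (a + 1)).natAbs = d from ha] at h
  simp only [Set.mem_Icc]
  omega

lemma hasSum_oblongSeries (z : Rˣ) :
    HasSum (fun a : ℤ => C ((z ^ a : Rˣ) : R) * (X : R⟦X⟧) ^ (a * (a + 1)).natAbs)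
      (oblongSeries z) :=
  (summable_C_mul_X_pow _ finite_natAbs_mul_succ_eq).hasSum

lemma int_mul_succ_nonneg (a : ℤ) : 0 ≤ a * (a + 1) := by
  rcases le_or_gt 0 a with h | h
  · positivity
  · nlinarith

/-- The bijection of `ℤ × ℤ` with two copies of itself, given by the parity of the sum of the
coordinates. -/
def sumDiffEquiv : (ℤ × ℤ) ⊕ (ℤ × ℤ) ≃ ℤ × ℤ where
  toFun := Sum.elim (fun p => (p.1 + p.2, p.1 - p.2)) (fun p => (p.1 + p.2 + 1, p.1 - p.2))
  invFun p := if (p.1 + p.2) % 2 = 0 then Sum.inl ((p.1 + p.2) / 2, (p.1 - p.2) / 2)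
    else Sum.inr ((p.1 + p.2) / 2, (p.1 - p.2) / 2)
  left_inv := by
    rintro (⟨a, b⟩ | ⟨a, b⟩)
    · have h : (a + b + (a - b)) % 2 = 0 := by omega
      simp only [Sum.elim_inl, h, if_true, Sum.inl.injEq, Prod.mk.injEq]
      omega
    · have h : ¬ (a + b + 1 + (a - b)) % 2 = 0 := by omega
      simp only [Sum.elim_inr, h, if_false, Sum.inr.injEq, Prod.mk.injEq]
      omega
  right_inv := by
    rintro ⟨a, b⟩
    by_cases h : (a + b) % 2 = 0
    · simp only [h, if_true, Sum.elim_inl, Prod.mk.injEq]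
      omega
    · simp only [h, if_false, Sum.elim_inr, Prod.mk.injEq]
      omega

/-- The indices n and -n-1 share the same exponent, so they are paired. -/
lemma hasSum_nat_oblongSeries (z : Rˣ) :
    HasSum (fun n : ℕ => C (((z ^ n : Rˣ) : R) + ((z⁻¹ ^ (n + 1) : Rˣ) : R)) *
      (X : R⟦X⟧) ^ (n * (n + 1))) (oblongSeries z) := by
  convert! (hasSum_oblongSeries z).nat_add_neg_add_one using 2 with n
  have e₁ : ((n : ℤ) * (n + 1)).natAbs = n * (n + 1) := by
    rw [← Int.natCast_succ, ← Int.natCast_mul, Int.natAbs_natCast]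
  have e₂ : (-((n : ℤ) + 1) * (-(n + 1) + 1)).natAbs = n * (n + 1) := by
    rw [← e₁]
    congr 1
    ring
  have e₃ : z ^ (-((n : ℤ) + 1)) = z⁻¹ ^ (n + 1) := by
    rw [zpow_neg, ← Int.natCast_succ, zpow_natCast, inv_pow]
  rw [e₁, e₂, e₃, zpow_natCast, map_add, add_mul]

lemma constantCoeff_thetaSeries [T2Space R] (z : Rˣ) : constantCoeff (thetaSeries z) = 1 := by
  have h := (hasSum_thetaSeries z).map (constantCoeff (R := R)) (continuous_constantCoeff R)
  refine h.unique ?_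
  convert! hasSum_ite_eq (0 : ℤ) (1 : R) using 2 with n
  by_cases hn : n = 0
  · simp [hn]
  · simp [hn]

lemma oblongSeries_neg_one [T2Space R] : oblongSeries (-1 : Rˣ) = 0 := by
  refine (hasSum_nat_oblongSeries (-1 : Rˣ)).unique ?_
  convert! hasSum_zero (α := R⟦X⟧) (β := ℕ) using 2 with n
  rw [pow_succ, inv_neg, inv_one]
  simp

variable [IsTopologicalRing R] [T3Space R]

lemma HasSum.mul_C_mul_X_pow {ι κ : Type*} {w : ι → R} {v : κ → R} {e : ι → ℕ} {f : κ → ℕ}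
    {s t : R⟦X⟧} (hs : HasSum (fun i => C (w i) * (X : R⟦X⟧) ^ e i) s)
    (ht : HasSum (fun j => C (v j) * (X : R⟦X⟧) ^ f j) t)
    (he : ∀ d, {i | e i = d}.Finite) (hf : ∀ d, {i | f i = d}.Finite) :
    HasSum (fun p : ι × κ => C (w p.1 * v p.2) * (X : R⟦X⟧) ^ (e p.1 + f p.2)) (s * t) := by
  have := t3Space_powerSeries (R := R)
  have hsum := summable_C_mul_X_pow (fun p : ι × κ => w p.1 * v p.2) (finite_add_eq he hf)
  have heq : ∀ p : ι × κ, C (w p.1 * v p.2) * (X : R⟦X⟧) ^ (e p.1 + f p.2) =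
      C (w p.1) * (X : R⟦X⟧) ^ e p.1 * (C (v p.2) * X ^ f p.2) := by
    intro p
    rw [map_mul, pow_add]
    ring
  simp_rw [heq] at hsum ⊢
  exact HasSum.mul (f := fun i => C (w i) * (X : R⟦X⟧) ^ e i)
    (g := fun j => C (v j) * (X : R⟦X⟧) ^ f j) hs ht hsum

/-- The even-odd dissection of the product of a theta series with the classical one. -/
theorem thetaSeries_mul_thetaSeries_one (z : Rˣ) :
    thetaSeries z * thetaSeries 1 = expand 2 two_ne_zero (thetaSeries z ^ 2) +
      C (z : R) * X * expand 2 two_ne_zero (oblongSeries z ^ 2) := by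
  -- (a+b)² + (a-b)² = 2(a²+b²), while (a+b+1)² + (a-b)² = 1 + 2(a(a+1) + b(b+1)).
  have h := sumDiffEquiv.hasSum_iff.mpr ((hasSum_thetaSeries z).mul_C_mul_X_pow
    (hasSum_thetaSeries 1) finite_natAbs_sq_eq finite_natAbs_sq_eq)
  have h₁ := ((hasSum_thetaSeries z).mul_C_mul_X_pow (hasSum_thetaSeries z)
    finite_natAbs_sq_eq finite_natAbs_sq_eq).powerSeries_expand 2 two_ne_zero
  have h₂ := (((hasSum_oblongSeries z).mul_C_mul_X_pow (hasSum_oblongSeries z)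
    finite_natAbs_mul_succ_eq finite_natAbs_mul_succ_eq).powerSeries_expand 2
      two_ne_zero).mul_left (C (z : R) * X)
  rw [sq, sq]
  refine h.unique (HasSum.sum ?_ ?_)
  · convert! h₁ using 2 with p
    simp only [Function.comp_apply, sumDiffEquiv, Equiv.coe_fn_mk, Sum.elim_inl, one_zpow,
      Units.val_one, mul_one, map_mul, map_pow, expand_C, expand_X, zpow_add, Units.val_mul]
    rw [← pow_mul]
    congr 2
    zify
    simp only [sq_abs]
    ring
  · convert! h₂ using 2 with p
    simp only [Function.comp_apply, sumDiffEquiv, Equiv.coe_fn_mk, Sum.elim_inr, one_zpow,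
      Units.val_one, mul_one, map_mul, map_pow, expand_C, expand_X, zpow_add, zpow_one,
      Units.val_mul]
    have e : (p.1 + p.2 + 1).natAbs ^ 2 + (p.1 - p.2).natAbs ^ 2 =
        1 + 2 * ((p.1 * (p.1 + 1)).natAbs + (p.2 * (p.2 + 1)).natAbs) := by
      zify
      simp only [sq_abs, abs_of_nonneg (int_mul_succ_nonneg _)]
      ring
    rw [e]
    ring

lemma thetaSeries_neg_one_mul_thetaSeries_one :
    thetaSeries (-1 : Rˣ) * thetaSeries 1 = expand 2 two_ne_zero (thetaSeries (-1 : Rˣ) ^ 2) := by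
  rw [thetaSeries_mul_thetaSeries_one, oblongSeries_neg_one]
  simp

end ThetaDissection

/-! ### The generating function as a quotient of theta series. -/

section GeneratingFunction

open PowerSeries PowerSeries.WithPiTopology Filter Topology

/-- The generating function of the numbers `PD 2 n`. -/
noncomputable def genFunPD (R : Type*) [CommRing R] : R⟦X⟧ :=
  PowerSeries.mk fun n => (PD 2 n : R)

/-- The designations of a partition number the product of its multiplicities; weight 0 on even sizes
removes the non-regular partitions. -/
lemma genFunPD_eq_genFun (R : Type*) [CommRing R] :
    genFunPD R = Nat.Partition.genFun fun i c => if 2 ∣ i then 0 else (c : R) := by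
  ext n
  have h : ∀ p : n.Partition,
      ((Multiset.toFinsupp p.parts).prod fun i c => if 2 ∣ i then 0 else (c : R)) =
        if p.IsRegular 2 then (Fintype.card p.Designation : R) else 0 := by
    intro p
    rw [Finsupp.prod, Multiset.toFinsupp_support]
    split_ifs with hp
    · rw [Fintype.card_pi, Nat.cast_prod, ← Finset.prod_attach]
      refine Finset.prod_congr rfl fun i _ => ?_
      rw [if_neg (hp i.1 (Multiset.mem_toFinset.mp i.2)), Fintype.card_fin,
        Multiset.toFinsupp_apply]
    · obtain ⟨i, hi, hi'⟩ : ∃ i ∈ p.parts, 2 ∣ i := by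
        simpa only [Nat.Partition.IsRegular, not_forall, not_not, exists_prop] using hp
      exact Finset.prod_eq_zero (Multiset.mem_toFinset.mpr hi) (if_pos hi')
  rw [genFunPD, coeff_mk, Nat.Partition.coeff_genFun, PD, Fintype.card_sigma, Nat.cast_sum,
    Finset.sum_congr rfl fun p _ => h p, ← Finset.sum_filter]
  exact (Finset.sum_subtype _ (fun _ => by simp) fun p : n.Partition => (Fintype.card p.Designation : R)).symm

variable {R : Type*} [CommRing R] [TopologicalSpace R] [IsTopologicalRing R] [T2Space R]

/-- This is ∑ c xᶜ = x/(1-x)² at x = Xⁱ: subtracting x times the series leaves a geometric series.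
-/
lemma tsum_succ_mul_pow_mul_one_sub_sq {i : ℕ} (hi : i ≠ 0) :
    (∑' j : ℕ, ((j + 1 : ℕ) : R) • (X : R⟦X⟧) ^ (i * (j + 1))) * (1 - X ^ i) ^ 2 = X ^ i := by
  have hS := (Nat.Partition.summable_genFun_term' (fun _ c => (c : R)) hi).hasSum
  set D := ∑' j : ℕ, ((j + 1 : ℕ) : R) • (X : R⟦X⟧) ^ (i * (j + 1)) with hD
  have h₁ : HasSum (fun j : ℕ => (j : R) • (X : R⟦X⟧) ^ (i * (j + 1))) (X ^ i * D) := by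
    refine (hasSum_nat_add_iff' 1).mp ?_
    rw [Finset.sum_range_one, Nat.cast_zero, zero_smul, sub_zero]
    convert! hS.mul_left (X ^ i : R⟦X⟧) using 2 with j
    rw [mul_smul_comm, ← pow_add]
    congr 2
    ring
  have hc : constantCoeff ((X : R⟦X⟧) ^ i) = 0 := by simp [hi]
  have h₂ := (summable_pow_of_constantCoeff_eq_zero hc).hasSum.mul_left (X ^ i : R⟦X⟧)
  have h₃ := (hS.sub h₁).unique (by
    convert! h₂ using 2 with j
    rw [← sub_smul, Nat.cast_succ, add_sub_cancel_left, one_smul]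
    ring)
  have h₄ := tsum_pow_mul_one_sub_of_constantCoeff_eq_zero hc
  linear_combination (1 - (X : R⟦X⟧) ^ i) * h₃ + (X : R⟦X⟧) ^ i * h₄

lemma genFunPD_mul_thetaSeries (z : Rˣ) (hz : (z : R) + ((z⁻¹ : Rˣ) : R) = -1) :
    genFunPD R * thetaSeries (-1) = thetaSeries z := by
  have h₁ := Nat.Partition.hasProd_genFun fun i c => if 2 ∣ i then 0 else (c : R)
  rw [← genFunPD_eq_genFun] at h₁
  have hinj : Function.Injective fun k : ℕ => 2 * k := fun a b h => by
    dsimp only at h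
    omega
  rw [← hinj.hasProd_iff] at h₁
  swap
  · intro i hi
    have hi' : 2 ∣ i + 1 := by
      by_contra h
      exact hi ⟨i / 2, by dsimp only; omega⟩
    simp [hi']
  have hm : ∀ w : Rˣ, Multipliable fun k : ℕ => (1 + C (w : R) * (X : R⟦X⟧) ^ (2 * k + 1)) *
      (1 + C ((w⁻¹ : Rˣ) : R) * X ^ (2 * k + 1)) := fun w =>
    (multipliable_one_add_C_mul_X_pow (w : R) (e := fun k => 2 * k + 1) fun k => by omega).mul
      (multipliable_one_add_C_mul_X_pow ((w⁻¹ : Rˣ) : R) (e := fun k => 2 * k + 1)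
        fun k => by omega)
  rw [← triple_product, ← triple_product, ← mul_assoc]
  congr 1
  refine (h₁.mul (hm (-1)).hasProd).unique ?_
  convert! (hm z).hasProd using 2 with k
  have h2 : ¬ 2 ∣ 2 * k + 1 := by omega
  simp only [Function.comp_apply, if_neg h2, inv_neg, inv_one, Units.val_neg, Units.val_one,
    map_neg, map_one]
  have h₃ := tsum_succ_mul_pow_mul_one_sub_sq (R := R) (i := 2 * k + 1) (by omega)
  have h₄ : C (z : R) + C ((z⁻¹ : Rˣ) : R) = -1 := by rw [← map_add, hz, map_neg, map_one]
  have h₅ : C (z : R) * C ((z⁻¹ : Rˣ) : R) = 1 := by rw [← map_mul, Units.mul_inv, map_one]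
  linear_combination h₃ - X ^ (2 * k + 1) * h₄ - (X ^ (2 * k + 1)) ^ 2 * h₅

end GeneratingFunction

/-! ### Descent to integer coefficients and congruences. -/

section Congruence

open PowerSeries PowerSeries.WithPiTopology

/-- The integer `ω ^ (n - 1) + ω ^ (1 - n)`, `ω` being a primitive cube root of unity. -/
def cubeRootTrace (n : ℕ) : ℤ := if n % 3 = 1 then 2 else -1

/-- The factor z² = z⁻¹ makes the paired coefficients zⁿ + z^(-n-1) symmetric under z ↦ z⁻¹, hence
integral. -/
lemma sq_mul_add_eq_cubeRootTrace {z : ℂˣ} (hz : (z : ℂ) + ((z⁻¹ : ℂˣ) : ℂ) = -1) (n : ℕ) :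
    (z : ℂ) ^ 2 * (((z ^ n : ℂˣ) : ℂ) + ((z⁻¹ ^ (n + 1) : ℂˣ) : ℂ)) = cubeRootTrace n := by
  have h₁ : (z : ℂ) * ((z⁻¹ : ℂˣ) : ℂ) = 1 := Units.mul_inv z
  rw [Units.val_pow_eq_pow_val, Units.val_pow_eq_pow_val]
  generalize ((z⁻¹ : ℂˣ) : ℂ) = w at *
  generalize (z : ℂ) = z at *
  have hw : w = z ^ 2 := by linear_combination hz - z * hz + h₁
  subst hw
  have h₂ : z ^ 3 = 1 := by linear_combination h₁
  have h₃ : z ^ n = z ^ (n % 3) := pow_eq_pow_mod n h₂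
  have h₄ : (z ^ 2) ^ (n + 1) = (z ^ 2) ^ (n % 3 + 1) := by
    rw [pow_succ _ n, pow_succ _ (n % 3), pow_eq_pow_mod n (show (z ^ 2) ^ 3 = 1 by
      linear_combination (z ^ 3 + 1) * h₂)]
  rw [h₃, h₄, cubeRootTrace]
  have h₅ : n % 3 < 3 := Nat.mod_lt _ (by norm_num)
  interval_cases n % 3
  · norm_num
    linear_combination hz + z * h₂
  · norm_num
    linear_combination (2 + z ^ 3) * h₂
  · norm_num
    linear_combination hz + z * h₂ + z ^ 2 * (z ^ 3 + 1) * h₂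

lemma exists_units_add_inv_eq_neg_one : ∃ z : ℂˣ, (z : ℂ) + ((z⁻¹ : ℂˣ) : ℂ) = -1 := by
  have h := Complex.isPrimitiveRoot_exp 3 (by norm_num)
  have h₁ := h.geom_sum_eq_zero (by norm_num)
  have h₂ := h.pow_eq_one
  generalize Complex.exp _ = ζ at *
  refine ⟨⟨ζ, ζ ^ 2, by linear_combination h₂, by linear_combination h₂⟩, ?_⟩
  simp only [Finset.sum_range_succ, Finset.sum_range_zero] at h₁
  simp only [Units.inv_mk]
  linear_combination h₁

lemma map_thetaSeries_neg_one :
    PowerSeries.map (Int.castRingHom ℂ) (thetaSeries (-1 : ℤˣ)) = thetaSeries (-1 : ℂˣ) := by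
  refine ((hasSum_thetaSeries (-1 : ℤˣ)).powerSeries_map (Int.castRingHom ℂ)
    continuous_of_discreteTopology).unique ?_
  convert! hasSum_thetaSeries (-1 : ℂˣ) using 2 with n
  rw [map_mul, map_pow, map_X, map_C]
  congr 2
  have h : Units.map (Int.castRingHom ℂ : ℤ →* ℂ) (-1) = -1 := by
    ext
    simp
  rw [← h, ← map_zpow]
  rfl

lemma exists_map_eq_sq_mul_oblongSeries {z : ℂˣ} (hz : (z : ℂ) + ((z⁻¹ : ℂˣ) : ℂ) = -1) :
    ∃ S : ℤ⟦X⟧, PowerSeries.map (Int.castRingHom ℂ) S = C ((z : ℂ) ^ 2) * oblongSeries z := by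
  have hfin : ∀ d, {n : ℕ | n * (n + 1) = d}.Finite := fun d =>
    (Set.finite_Iic d).subset fun n hn => by
      have hn' : n * (n + 1) = d := hn
      simp only [Set.mem_Iic]
      nlinarith
  refine ⟨_, ((summable_C_mul_X_pow cubeRootTrace hfin).hasSum.powerSeries_map (Int.castRingHom ℂ)
    continuous_of_discreteTopology).unique ?_⟩
  convert! (hasSum_nat_oblongSeries z).mul_left (C ((z : ℂ) ^ 2)) using 2 with n
  rw [← mul_assoc, ← map_mul, sq_mul_add_eq_cubeRootTrace hz, map_mul, map_pow, map_X, map_C]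
  rfl

/-- The even-odd dissection of the generating function of the numbers `PD 2 n`. -/
theorem exists_genFunPD_eq_expand_add :
    ∃ Y : ℤ⟦X⟧, genFunPD ℤ = expand 2 two_ne_zero (genFunPD ℤ ^ 2) +
      X * expand 2 two_ne_zero (Y ^ 2) := by
  obtain ⟨z, hz⟩ := exists_units_add_inv_eq_neg_one
  obtain ⟨S, hS⟩ := exists_map_eq_sq_mul_oblongSeries hz
  set T := thetaSeries (-1 : ℤˣ) with hT
  obtain ⟨V, hV⟩ : IsUnit T := by
    rw [isUnit_iff_constantCoeff, constantCoeff_thetaSeries]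
    exact isUnit_one
  have hF : PowerSeries.map (Int.castRingHom ℂ) (genFunPD ℤ) = genFunPD ℂ := by
    ext n
    simp [genFunPD]
  -- Hence (z² `oblongSeries z`)² = z (`oblongSeries z`)², which absorbs the coefficient z of the
  -- odd part.
  have hz₄ : (z : ℂ) ^ 4 = z := by
    have h₁ : (z : ℂ) * ((z⁻¹ : ℂˣ) : ℂ) = 1 := Units.mul_inv z
    linear_combination (z ^ 3 - z ^ 2) * hz - (z ^ 2 - z) * h₁
  have key : genFunPD ℤ * expand 2 two_ne_zero (T ^ 2) =
      expand 2 two_ne_zero ((genFunPD ℤ * T) ^ 2) + X * expand 2 two_ne_zero (S ^ 2) := by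
    apply map_injective (Int.castRingHom ℂ) Int.cast_injective
    have h₁ := genFunPD_mul_thetaSeries z hz
    have h₂ := thetaSeries_mul_thetaSeries_one z
    have h₃ := thetaSeries_neg_one_mul_thetaSeries_one (R := ℂ)
    have h₄ : C ((z : ℂ) ^ 2) ^ 2 = C (z : ℂ) := by
      rw [← map_pow, ← pow_mul, hz₄]
    simp only [map_mul, map_add, map_expand, map_pow, map_X, hF, map_thetaSeries_neg_one, hT, hS,
      expand_C] at h₂ h₃ h₄ ⊢
    rw [← h₁] at h₂
    simp only [map_mul] at h₂
    linear_combination h₂ - genFunPD ℂ * h₃ -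
      X * expand 2 two_ne_zero (oblongSeries z) ^ 2 * h₄
  have hW : T * ((V⁻¹ : ℤ⟦X⟧ˣ) : ℤ⟦X⟧) = 1 := by rw [← hV, Units.mul_inv]
  generalize ((V⁻¹ : ℤ⟦X⟧ˣ) : ℤ⟦X⟧) = W at hW
  have hW' := congrArg (expand 2 two_ne_zero) hW
  refine ⟨S * W, ?_⟩
  simp only [map_mul, map_pow, map_one] at key hW' ⊢
  generalize expand 2 two_ne_zero W = W' at *
  generalize expand 2 two_ne_zero T = T' at *
  linear_combination W' ^ 2 * key + (expand 2 two_ne_zero (genFunPD ℤ) ^ 2 - genFunPD ℤ) *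
    (T' * W' + 1) * hW'

/-- Frobenius over `ZMod 2`. -/
lemma dvd_sq_sub_expand (G : ℤ⟦X⟧) : (2 : ℤ⟦X⟧) ∣ G ^ 2 - expand 2 two_ne_zero G := by
  have h : PowerSeries.map (Int.castRingHom (ZMod 2)) (G ^ 2 - expand 2 two_ne_zero G) = 0 := by
    have h₁ := MvPowerSeries.map_frobenius_expand 2 two_ne_zero
      (f := PowerSeries.map (Int.castRingHom (ZMod 2)) G)
    rw [ZMod.frobenius_zmod] at h₁
    rw [map_sub, map_pow, map_expand, sub_eq_zero]
    exact h₁.symm.trans (congrFun (congrArg DFunLike.coe MvPowerSeries.map_id) _)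
  have hC : (2 : ℤ⟦X⟧) = C 2 := rfl
  have : ∀ n, (2 : ℤ) ∣ coeff n (G ^ 2 - expand 2 two_ne_zero G) := fun n => by
    have := congrArg (coeff n) h
    rw [coeff_map, map_zero, eq_intCast] at this
    exact_mod_cast (ZMod.intCast_zmod_eq_zero_iff_dvd _ 2).mp this
  choose f hf using this
  refine ⟨PowerSeries.mk f, ?_⟩
  ext n
  rw [hf, hC, coeff_C_mul, coeff_mk]

/-- Squaring a congruence mod 2 gives one mod 4. -/
lemma dvd_pow_four_sub_expand_sq (G : ℤ⟦X⟧) :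
    (4 : ℤ⟦X⟧) ∣ G ^ 4 - expand 2 two_ne_zero (G ^ 2) := by
  obtain ⟨H, hH⟩ := dvd_sq_sub_expand G
  refine ⟨H * expand 2 two_ne_zero G + H ^ 2, ?_⟩
  rw [map_pow]
  linear_combination (G ^ 2 + expand 2 two_ne_zero G + 2 * H) * hH

lemma coeff_expand_add_X_mul_expand {R : Type*} [CommRing R] (A B : R⟦X⟧) (n : ℕ) :
    coeff (2 * n) (expand 2 two_ne_zero A + X * expand 2 two_ne_zero B) = coeff n A := by
  rw [map_add, coeff_expand_mul, add_eq_left]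
  cases n with
  | zero => simp
  | succ n =>
    rw [show 2 * (n + 1) = (2 * n + 1) + 1 by ring, coeff_succ_X_mul,
      coeff_expand_of_not_dvd _ _ _ (by omega)]

end Congruence

theorem mainTheorem4 (n : ℕ) : PD 2 (4 * n) ≡ PD 2 n [MOD 4] := by
  open PowerSeries in
  obtain ⟨Y, hY⟩ := exists_genFunPD_eq_expand_add
  set F := genFunPD ℤ with hF
  have hc : ∀ m, (PD 2 m : ℤ) = coeff m F := fun m => by rw [hF, genFunPD, coeff_mk]
  have h₁ : coeff (4 * n) F = coeff n (F ^ 4 + X * Y ^ 4) := by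
    -- Squaring the dissection: the cross term is odd, and q² Y(q²)⁴ is even.
    have h₂ : F ^ 2 = expand 2 two_ne_zero (F ^ 4 + X * Y ^ 4) +
        X * expand 2 two_ne_zero (2 * F ^ 2 * Y ^ 2) := by
      conv_lhs => rw [hY]
      simp only [map_add, map_mul, map_pow, expand_X, map_ofNat]
      ring
    rw [show 4 * n = 2 * (2 * n) by ring, congrArg (coeff _) hY, coeff_expand_add_X_mul_expand,
      congrArg (coeff _) h₂, coeff_expand_add_X_mul_expand]
  obtain ⟨A, hA⟩ := dvd_pow_four_sub_expand_sq F
  obtain ⟨B, hB⟩ := dvd_pow_four_sub_expand_sq Y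
  have h₃ : F ^ 4 + X * Y ^ 4 = F + C 4 * (A + X * B) := by
    rw [show (C 4 : ℤ⟦X⟧) = 4 from rfl]
    linear_combination hA + X * hB - hY
  rw [← Int.natCast_modEq_iff, hc, hc, h₁, h₃, map_add, coeff_C_mul]
  exact (Int.modEq_iff_dvd.mpr ⟨coeff n (A + X * B), by push_cast; ring⟩).symm
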